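/- Let $\mathbb{R}^2_S$ be the set $\mathbb{R}^2$ with the spaghetti (wire) diffeology, i.e. the diffeology generated by all smooth maps $\mathbb{R}\to\mathbb{R}^2$. For a diffeological space $X$ and $x\in X$, let $T_x(X)$ be the colimit, in real vector spaces, of $T_0(U)$ over the category of pointed plots $(U,0)\to(X,x)$ and pointed smooth maps over $X$. On the set $TX=\coprod_{x\in X}T_x(X)$, Hector's diffeology is the one generated by the maps $TU\to TX$ induced by the plots $U\to X$. The dvs diffeology is the smallest diffeology on $TX$ that contains Hector's diffeology and makes $TX\to X$ a diffeological vector pseudo-bundle, i.e. makes the projection, the fibrewise addition, the fibrewise scalar multiplication and the zero section smooth. Write $T^{\mathrm{dvs}}_x(X)$ for $T_x(X)$ with the subset diffeology of the dvs diffeology. **Proposition.** For every $x\in\mathbb{R}^2_S$, $T^{\mathrm{dvs}}_x(\mathbb{R}^2_S)$ is a fine diffeological vector space: its diffeology is the smallest one for which its addition and scalar multiplication are smooth. Moreover, every linear map $T^{\mathrm{dvs}}_x(\mathbb{R}^2_S)\to\mathbb{R}$ is smooth. -/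

import Mathlib

open scoped ContDiff

noncomputable section

namespace Diffeology

universe u v

/- Diffeological spaces, plots and smooth maps are Mathlib's `DiffeologicalSpace`, `IsPlot` and
`DSmooth`. There the plots are recorded on the test spaces `ℝⁿ`, `n : ℕ`; a map defined on an open
subset `U` of `ℝⁿ` is a plot iff its composites with all smooth maps `ℝᵐ → U` are, so nothing is
lost against the convention in which arbitrary open subsets are used as domains. Diffeologies on a
set are ordered by inclusion of their sets of plots, and `sInf` is intersection. -/

/-! ### Subset diffeology -/

/-- The diffeology on `X` induced by `i : X → Y`: a map into `X` is a plot iff its composite with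
`i` is a plot of `Y`. For injective `i` this is the subset diffeology. -/
@[reducible]
def inducedDiffeology {X : Type u} {Y : Type v} [DiffeologicalSpace Y] (i : X → Y) :
    DiffeologicalSpace X where
  plots n := {p | IsPlot (fun w : EuclideanSpace ℝ (Fin n) => i (p w))}
  constant_plots x := isPlot_const
  plot_reparam hp hf := isPlot_reparam hp hf
  locality hp := DiffeologicalSpace.locality (X := Y) fun x =>
    let ⟨s, hs, hx, h⟩ := hp x
    ⟨s, hs, hx, fun hfs hf => h hfs hf⟩

/-! ### Diffeological vector spaces and the fine diffeology -/

/-- A diffeological vector space: addition `V × V → V` and scalar multiplication `ℝ × V → V` are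
smooth. Plots of a product are pairs of plots. -/
structure IsDiffeologicalVectorSpace (V : Type u) [AddCommGroup V] [Module ℝ V]
    [DiffeologicalSpace V] : Prop where
  add : ∀ (n : ℕ) (p q : EuclideanSpace ℝ (Fin n) → V), IsPlot p → IsPlot q →
    IsPlot (fun w => p w + q w)
  smul : ∀ (n : ℕ) (r : EuclideanSpace ℝ (Fin n) → ℝ) (p : EuclideanSpace ℝ (Fin n) → V),
    IsPlot r → IsPlot p → IsPlot (fun w => r w • p w)

/-- `V` is a fine diffeological vector space: its diffeology is the smallest one making the vector
space `V` a diffeological vector space. -/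
def IsFineDiffeologicalVectorSpace (V : Type u) [AddCommGroup V] [Module ℝ V]
    [d : DiffeologicalSpace V] : Prop :=
  IsLeast {d' : DiffeologicalSpace V | @IsDiffeologicalVectorSpace V _ _ d'} d

/-! ### Diffeological vector pseudo-bundles and dvsification -/

section Bundle

variable {B : Type u} (F : B → Type v) [DiffeologicalSpace B]
  [∀ b, AddCommGroup (F b)] [∀ b, Module ℝ (F b)]

/-- The diffeology on the total space `Σ b, F b` makes the projection to `B` a diffeological vector
pseudo-bundle: the projection, the fibrewise addition `E ×_B E → E`, the fibrewise scalar
multiplication `ℝ × E → E` and the zero section `B → E` are smooth. Plots of `E ×_B E` are pairs of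
plots of `E` over the same map to `B`. -/
structure IsVectorPseudoBundle [DiffeologicalSpace (Σ b, F b)] : Prop where
  proj : DSmooth (Sigma.fst : (Σ b, F b) → B)
  add : ∀ (n : ℕ) (q : EuclideanSpace ℝ (Fin n) → B) (s t : ∀ w, F (q w)),
    IsPlot (fun w => (⟨q w, s w⟩ : Σ b, F b)) → IsPlot (fun w => (⟨q w, t w⟩ : Σ b, F b)) →
      IsPlot (fun w => (⟨q w, s w + t w⟩ : Σ b, F b))
  smul : ∀ (n : ℕ) (q : EuclideanSpace ℝ (Fin n) → B) (r : EuclideanSpace ℝ (Fin n) → ℝ)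
    (s : ∀ w, F (q w)), IsPlot r → IsPlot (fun w => (⟨q w, s w⟩ : Σ b, F b)) →
      IsPlot (fun w => (⟨q w, r w • s w⟩ : Σ b, F b))
  zero : DSmooth (fun b => (⟨b, 0⟩ : Σ b, F b))

/-- Dvsification of a diffeology `d` on the total space: the smallest diffeology that contains `d`
and makes the projection a diffeological vector pseudo-bundle. -/
@[reducible]
def dvsification (d : DiffeologicalSpace (Σ b, F b)) : DiffeologicalSpace (Σ b, F b) :=
  sInf {d' | d ≤ d' ∧ @IsVectorPseudoBundle B F _ _ _ d'}

/-- If the projection is smooth for `d`, the smallest diffeology in question exists. -/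
theorem isLeast_dvsification (d : DiffeologicalSpace (Σ b, F b))
    (hd : @DSmooth _ _ d _ (Sigma.fst : (Σ b, F b) → B)) :
    IsLeast {d' | d ≤ d' ∧ @IsVectorPseudoBundle B F _ _ _ d'} (dvsification F d) := by
  refine ⟨⟨le_sInf fun d' h => h.1, ?_⟩, fun d' h => sInf_le h⟩
  -- the pullback of the diffeology of `B` competes, which gives smoothness of the projection
  have hB : d ≤ inducedDiffeology (Sigma.fst : (Σ b, F b) → B) ∧
      @IsVectorPseudoBundle B F _ _ _ (inducedDiffeology (Sigma.fst : (Σ b, F b) → B)) :=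
    ⟨DiffeologicalSpace.le_iff'.2 hd,
      @IsVectorPseudoBundle.mk B F _ _ _ (inducedDiffeology (Sigma.fst : (Σ b, F b) → B))
        (fun _ _ hp => hp) (fun _ _ _ _ hs _ => hs) (fun _ _ _ _ _ hs => hs) (fun _ _ hp => hp)⟩
  have key {n : ℕ} {p : EuclideanSpace ℝ (Fin n) → Σ b, F b} :=
    DiffeologicalSpace.isPlot_sInf_iff (p := p)
      (D := {d' | d ≤ d' ∧ @IsVectorPseudoBundle B F _ _ _ d'})
  exact @IsVectorPseudoBundle.mk B F _ _ _ (dvsification F d)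
    (fun n p hp => key.1 hp _ hB)
    (fun n q s t hs ht => key.2 fun d' h => @IsVectorPseudoBundle.add B F _ _ _ d' h.2 n q s t
      (key.1 hs d' h) (key.1 ht d' h))
    (fun n q r s hr hs => key.2 fun d' h => @IsVectorPseudoBundle.smul B F _ _ _ d' h.2 n q r s
      hr (key.1 hs d' h))
    (fun n p hp => key.2 fun d' h => @IsVectorPseudoBundle.zero B F _ _ _ d' h.2 n p hp)

end Bundle

/-! ### Internal tangent spaces -/

section Tangent

variable (X : Type u) [DiffeologicalSpace X]

variable {X} in
/-- A pointed plot `(ℝⁿ, 0) → (X, x)`. -/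
structure PointedPlot (x : X) where
  dim : ℕ
  toFun : EuclideanSpace ℝ (Fin dim) → X
  isPlot : IsPlot toFun
  map_zero : toFun 0 = x

/-- A plot, translated so that it becomes a plot pointed at its value at `a`. -/
def PointedPlot.ofPlot {X : Type u} [DiffeologicalSpace X] {n : ℕ}
    (p : EuclideanSpace ℝ (Fin n) → X) (hp : IsPlot p) (a : EuclideanSpace ℝ (Fin n)) :
    PointedPlot (p a) where
  dim := n
  toFun := fun w => p (a + w)
  isPlot := isPlot_reparam hp (contDiff_const.add contDiff_id)
  map_zero := by rw [add_zero]

open Classical in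
/-- The relations defining the colimit: for every pointed smooth map `f` from the pointed plot `p`
to the pointed plot `q` (so `q ∘ f = p`), a vector `v` at `p` is identified with `f_* v` at `q`. -/
def tangentRelations (x : X) :
    Submodule ℝ (DirectSum (PointedPlot x) fun p => EuclideanSpace ℝ (Fin p.dim)) :=
  Submodule.span ℝ {z | ∃ (p q : PointedPlot x)
    (f : EuclideanSpace ℝ (Fin p.dim) → EuclideanSpace ℝ (Fin q.dim))
    (v : EuclideanSpace ℝ (Fin p.dim)),
    ContDiff ℝ ∞ f ∧ f 0 = 0 ∧ (∀ w, q.toFun (f w) = p.toFun w) ∧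
    z = DirectSum.lof ℝ (PointedPlot x) (fun p => EuclideanSpace ℝ (Fin p.dim)) p v -
      DirectSum.lof ℝ (PointedPlot x) (fun p => EuclideanSpace ℝ (Fin p.dim)) q (fderiv ℝ f 0 v)}

/-- The internal tangent space `T_x X`: the colimit in real vector spaces, over the category of
pointed plots `p : (U, 0) → (X, x)` and pointed smooth maps over `X`, of the spaces `T_0 U`. It is
written as the direct sum of all the `T_0 U` modulo the relations given by the morphisms. -/
def InternalTangentSpace (x : X) : Type u :=
  (DirectSum (PointedPlot x) fun p => EuclideanSpace ℝ (Fin p.dim)) ⧸ tangentRelations X x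

instance (x : X) : AddCommGroup (InternalTangentSpace X x) :=
  inferInstanceAs (AddCommGroup
    ((DirectSum (PointedPlot x) fun p => EuclideanSpace ℝ (Fin p.dim)) ⧸ tangentRelations X x))

instance (x : X) : Module ℝ (InternalTangentSpace X x) :=
  inferInstanceAs (Module ℝ
    ((DirectSum (PointedPlot x) fun p => EuclideanSpace ℝ (Fin p.dim)) ⧸ tangentRelations X x))

variable {X} in
open Classical in
/-- The canonical linear map `p_* : T_0 U → T_x X` of a pointed plot `p : (U, 0) → (X, x)`. -/
def PointedPlot.push {x : X} (p : PointedPlot x) :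
    EuclideanSpace ℝ (Fin p.dim) →ₗ[ℝ] InternalTangentSpace X x :=
  (tangentRelations X x).mkQ ∘ₗ
    DirectSum.lof ℝ (PointedPlot x) (fun p => EuclideanSpace ℝ (Fin p.dim)) p

/-- The internal tangent bundle, as a set. -/
abbrev InternalTangentBundle : Type u := Σ x : X, InternalTangentSpace X x

variable {X} in
/-- The map `Tp : TU → TX` induced by a plot `p : U → X`, where `U = ℝⁿ` and `TU = ℝⁿ × ℝⁿ`. -/
def tangentMap {n : ℕ} (p : EuclideanSpace ℝ (Fin n) → X) (hp : IsPlot p)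
    (z : EuclideanSpace ℝ (Fin n) × EuclideanSpace ℝ (Fin n)) : InternalTangentBundle X :=
  ⟨p z.1, (PointedPlot.ofPlot p hp z.1).push z.2⟩

/-- Hector's diffeology on `TX`: the diffeology generated by the maps `Tp : TU → TX` for all plots
`p : U → X`. As `TU = ℝⁿ × ℝⁿ` is not literally one of the test spaces `ℝᵐ`, the generators are the
composites of the `Tp` with all smooth maps `ℝᵐ → TU`. -/
@[reducible]
def hectorDiffeology : DiffeologicalSpace (InternalTangentBundle X) :=
  DiffeologicalSpace.generateFrom {P | ∃ (n : ℕ) (p : EuclideanSpace ℝ (Fin n) → X) (hp : IsPlot p)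
    (m : ℕ) (g : EuclideanSpace ℝ (Fin m) → EuclideanSpace ℝ (Fin n) × EuclideanSpace ℝ (Fin n)),
    ContDiff ℝ ∞ g ∧ P = ⟨m, fun w => tangentMap p hp (g w)⟩}

/-- The internal tangent bundle carries the dvs diffeology, the dvsification of Hector's
diffeology. -/
instance dvsDiffeology : DiffeologicalSpace (InternalTangentBundle X) :=
  dvsification (InternalTangentSpace X) (hectorDiffeology X)

/-- The tangent space at `x` carries the subset diffeology of the dvs diffeology on the internal
tangent bundle. -/
instance (x : X) : DiffeologicalSpace (InternalTangentSpace X x) :=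
  inducedDiffeology (fun v => (⟨x, v⟩ : InternalTangentBundle X))

end Tangent

/-! ### The plane with the spaghetti diffeology -/

/-- The set `ℝ²`, to be equipped with the spaghetti (wire) diffeology. -/
def SpaghettiPlane : Type := EuclideanSpace ℝ (Fin 2)

/-- The spaghetti (wire) diffeology on `ℝ²`: the diffeology generated by all smooth curves
`ℝ → ℝ²`. -/
instance : DiffeologicalSpace SpaghettiPlane :=
  DiffeologicalSpace.generateFrom (X := EuclideanSpace ℝ (Fin 2))
    {P | ∃ c : ℝ → EuclideanSpace ℝ (Fin 2), ContDiff ℝ ∞ c ∧ P = ⟨1, fun t => c (t 0)⟩}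

end Diffeology

end

open scoped ContDiff
open Set Filter Topology

/-! ### Flat functions and the cube root -/

section FlatFunctions

variable {E : Type*} [NormedAddCommGroup E] [NormedSpace ℝ E]

/-! A plot of the spaghetti plane factors locally through a smooth curve c. So a plot of Hector's
diffeology lying over x consists locally of tangent vectors of one curve c, taken at parameters
where c = x, and over a ball these parameters fill an interval. If the interval is a point, the
vectors are smooth multiples of a single tangent vector. Otherwise c is constant on the interval and
the vectors vanish, even at an endpoint s: there c is flat, hence a smooth function of (t - s)^3
(`exists_contDiff_comp_pow_three`), and t ↦ (t - s)^3 kills tangent vectors at s. In both cases the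
plot is locally k(w) • e (`exists_eqOn_smul_of_tangentMap_eq`), which is a plot of every vector
space diffeology on T_x.

This suffices: a vector space diffeology d on T_x extends to the pseudo-bundle diffeology
`fibreDiffeology x d`. Once that contains Hector's diffeology it contains the dvs diffeology, and
restriction to the fibre gives minimality. -/

theorem deriv_eqOn_zero_of_isOpen {F : ℝ → E} {U : Set ℝ} (hU : IsOpen U)
    (h : ∀ t ∈ U, F t = 0) : ∀ t ∈ U, deriv F t = 0 := by
  intro t ht
  have : F =ᶠ[𝓝 t] fun _ => (0 : E) := by
    filter_upwards [hU.mem_nhds ht] with s hs using h s hs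
  rw [this.deriv_eq, deriv_const]

/-- A smooth function that vanishes on an open set is flat at the points of its closure. -/
theorem exists_norm_le_pow_of_eqOn_zero {U : Set ℝ} (hU : IsOpen U) (h0 : (0 : ℝ) ∈ closure U)
    (N : ℕ) : ∀ {F : ℝ → E}, ContDiff ℝ ∞ F → (∀ t ∈ U, F t = 0) →
      ∃ C, ∀ t, |t| ≤ 1 → ‖F t‖ ≤ C * |t| ^ N := by
  induction N with
  | zero =>
    intro F hF _
    obtain ⟨C, hC⟩ := (isCompact_Icc (a := (-1 : ℝ)) (b := 1)).exists_bound_of_continuousOn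
      hF.continuous.continuousOn
    exact ⟨C, fun t ht => by simpa using hC t (abs_le.1 ht)⟩
  | succ N ih =>
    intro F hF hFU
    have hF0 : F 0 = 0 :=
      closure_minimal hFU (isClosed_eq hF.continuous continuous_const) h0
    have hF' : ContDiff ℝ ∞ (deriv F) := (contDiff_infty_iff_deriv.1 hF).2
    obtain ⟨C, hC⟩ := ih hF' (deriv_eqOn_zero_of_isOpen hU hFU)
    have hC0 : 0 ≤ C := by simpa using (norm_nonneg _).trans (hC 1 (by simp))
    refine ⟨C, fun t ht => ?_⟩
    have := (convex_closedBall (0 : ℝ) |t|).norm_image_sub_le_of_norm_deriv_le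
      (f := F) (C := C * |t| ^ N) (x := 0) (y := t)
      (fun s _ => (hF.differentiable (by simp)) s)
      (fun s hs => by
        have hs' : |s| ≤ |t| := by simpa using hs
        refine (hC s (hs'.trans ht)).trans ?_
        gcongr)
      (by simp) (by simp)
    simpa [hF0, pow_succ, mul_assoc] using this

/-- Differentiating g⁻ʲ F(g), with g the cube root, gives the same shape again: j becomes j + 3 and
F becomes u ↦ (u F'(u) - j F(u)) / 3, still smooth and zero on U. Hence the induction on n covers
all j and F at once, although only j = 0 is used in the end. -/
theorem contDiff_inv_pow_smul_comp_cbrt {U : Set ℝ} (hU : IsOpen U) (h0 : (0 : ℝ) ∈ closure U)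
    {g : ℝ → ℝ} (hg : Continuous g) (hg3 : ∀ s, g s ^ 3 = s) (n : ℕ) :
    ∀ (j : ℕ) {F : ℝ → E}, ContDiff ℝ ∞ F → (∀ t ∈ U, F t = 0) →
      ContDiff ℝ n (fun s => ((g s)⁻¹ ^ j) • F (g s)) := by
  have hg0 : ∀ {s}, g s = 0 ↔ s = 0 := by
    intro s
    conv_rhs => rw [← hg3 s]
    simp
  have key : ∀ (j : ℕ) {F : ℝ → E}, ContDiff ℝ ∞ F → (∀ t ∈ U, F t = 0) → ∀ s,
      HasDerivAt (fun s => ((g s)⁻¹ ^ j) • F (g s))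
        (((g s)⁻¹ ^ (j + 3)) • ((1 / 3 : ℝ) • (g s • deriv F (g s) - (j : ℝ) • F (g s)))) s := by
    intro j F hF hFU s
    by_cases hs : s = 0
    · subst hs
      -- The exponent j + 6 leaves |g s|^6 = s^2 after division by g(s)^j, so the derivative at 0 is
      -- 0. The claimed value is 0 as well, since `0⁻¹ = 0`.
      obtain ⟨C, hC⟩ := exists_norm_le_pow_of_eqOn_zero hU h0 (j + 6) hF hFU
      have hg00 : g 0 = 0 := hg0.2 rfl
      have hO : (fun s => ((g s)⁻¹ ^ j) • F (g s)) =O[𝓝 0] fun s => ‖s - 0‖ ^ 2 := by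
        refine Asymptotics.IsBigO.of_bound C ?_
        have : ∀ᶠ s in 𝓝 (0 : ℝ), |g s| < 1 :=
          (hg.abs.tendsto 0).eventually_lt_const (by simp [hg00])
        filter_upwards [this] with s hs
        by_cases hs0 : g s = 0
        · have : F 0 = 0 := closure_minimal hFU (isClosed_eq hF.continuous continuous_const) h0
          have hs1 : s = 0 := hg0.1 hs0
          subst hs1
          simp [hg00, this]
        · have hpos : 0 < |g s| := abs_pos.2 hs0
          have h1 := hC (g s) hs.le
          have h2 : ‖‖s - 0‖ ^ 2‖ = |g s| ^ 6 := by
            conv_lhs => rw [← hg3 s]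
            simp
            ring
          rw [norm_smul, h2, norm_pow, norm_inv, Real.norm_eq_abs, inv_pow]
          rw [inv_mul_le_iff₀ (by positivity)]
          calc _ ≤ _ := h1
            _ = _ := by ring
      have := (hO.hasFDerivAt (by norm_num)).hasDerivAt
      simpa [hg00] using this
    · have hgs : g s ≠ 0 := fun h => hs (hg0.1 h)
      have h1 : HasDerivAt g (3 * g s ^ 2)⁻¹ s := by
        refine HasDerivAt.of_local_left_inverse (f := fun t => t ^ 3) hg.continuousAt ?_
          (by positivity) (Eventually.of_forall hg3)
        simpa using hasDerivAt_pow 3 (g s)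
      have hF1 : HasDerivAt F (deriv F (g s)) (g s) :=
        ((hF.differentiable (by simp)) (g s)).hasDerivAt
      have h2 := ((h1.fun_inv hgs).fun_pow j).fun_smul (hF1.scomp s h1)
      refine h2.congr_deriv ?_
      have e1 : (g s)⁻¹ ^ (j + 3) * (1 / 3 * g s) = (g s)⁻¹ ^ j * (3 * g s ^ 2)⁻¹ := by
        simp only [inv_pow, pow_add]
        field_simp
      have e2 : -((g s)⁻¹ ^ (j + 3) * (1 / 3 * (j : ℝ))) =
          j * (g s)⁻¹ ^ (j - 1) * (-(3 * g s ^ 2)⁻¹ / g s ^ 2) := by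
        rcases j with _ | j
        · simp
        · simp only [Nat.add_sub_cancel, inv_pow, pow_add]
          field_simp
      simp only [smul_sub, smul_smul, Function.comp_apply]
      rw [e1, ← e2, neg_smul, ← sub_eq_add_neg]
  induction n with
  | zero =>
    intro j F hF hFU
    exact contDiff_zero.2 (continuous_iff_continuousAt.2 fun s => (key j hF hFU s).continuousAt)
  | succ n ih =>
    intro j F hF hFU
    have hF' : ContDiff ℝ ∞ (deriv F) := (contDiff_infty_iff_deriv.1 hF).2
    push_cast
    refine contDiff_succ_iff_deriv.2 ⟨fun s => (key j hF hFU s).differentiableAt, by simp, ?_⟩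
    rw [funext fun s => (key j hF hFU s).deriv]
    refine ih (j + 3) (F := fun u => (1 / 3 : ℝ) • (u • deriv F u - (j : ℝ) • F u)) ?_ ?_
    · exact ((contDiff_id.smul hF').sub (hF.const_smul _)).const_smul _
    · intro t ht
      simp [hFU t ht, deriv_eqOn_zero_of_isOpen hU hFU t ht]

/-- A smooth function that vanishes on an open set whose closure contains `0` is a smooth function
of `t ^ 3`. -/
theorem exists_contDiff_comp_pow_three {U : Set ℝ} (hU : IsOpen U) (h0 : (0 : ℝ) ∈ closure U)
    {F : ℝ → E} (hF : ContDiff ℝ ∞ F) (hFU : ∀ t ∈ U, F t = 0) :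
    ∃ G : ℝ → E, ContDiff ℝ ∞ G ∧ ∀ t, G (t ^ 3) = F t := by
  have hmono : StrictMono fun t : ℝ => t ^ 3 := Odd.strictMono_pow (by decide)
  have hsurj : Function.Surjective fun t : ℝ => t ^ 3 := by
    refine (continuous_pow 3).surjective (tendsto_pow_atTop (by norm_num)) ?_
    rw [← tendsto_neg_atTop_iff, ← tendsto_comp_neg_atTop_iff]
    simp [Odd.neg_pow (by decide : Odd 3)]
  let e := hmono.orderIsoOfSurjective _ hsurj
  refine ⟨fun s => F (e.symm s), ?_, fun t => ?_⟩
  · refine contDiff_infty.2 fun n => ?_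
    simpa using contDiff_inv_pow_smul_comp_cbrt hU h0 e.symm.continuous
      (fun s => e.apply_symm_apply s) n 0 hF hFU
  · exact congrArg F (e.symm_apply_apply t)

end FlatFunctions

namespace Diffeology

/-- A smooth map into a given neighbourhood of `a` that is the identity near `a`. -/
theorem exists_contDiff_mapsTo_eventuallyEq_id {n : ℕ} {a : EuclideanSpace ℝ (Fin n)}
    {u : Set (EuclideanSpace ℝ (Fin n))} (hu : u ∈ 𝓝 a) :
    ∃ ρ : EuclideanSpace ℝ (Fin n) → EuclideanSpace ℝ (Fin n),
      ContDiff ℝ ∞ ρ ∧ (∀ w, ρ w ∈ u) ∧ ρ =ᶠ[𝓝 a] id := by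
  obtain ⟨ε, hε, hεu⟩ := Metric.mem_nhds_iff.1 hu
  let χ : ContDiffBump a := ⟨ε / 2, ε, by positivity, by linarith⟩
  refine ⟨fun w => a + χ w • (w - a),
    contDiff_const.add (χ.contDiff.smul (contDiff_id.sub contDiff_const)), fun w => hεu ?_, ?_⟩
  · rw [Metric.mem_ball, dist_eq_norm, add_sub_cancel_left, norm_smul, Real.norm_eq_abs,
      abs_of_nonneg χ.nonneg]
    by_cases hw : dist w a < ε
    · rw [← dist_eq_norm]
      exact (mul_le_of_le_one_left dist_nonneg χ.le_one).trans_lt hw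
    · rw [χ.zero_of_le_dist (not_lt.1 hw)]
      simpa using hε
  · filter_upwards [χ.eventuallyEq_one] with w hw
    simp [hw]

/-! ### Tangent vectors -/

section Push

variable {X : Type*} [DiffeologicalSpace X] {x : X}

theorem PointedPlot.push_eq_push_of_hasFDerivAt (p q : PointedPlot x)
    {f : EuclideanSpace ℝ (Fin p.dim) → EuclideanSpace ℝ (Fin q.dim)}
    {f' : EuclideanSpace ℝ (Fin p.dim) →L[ℝ] EuclideanSpace ℝ (Fin q.dim)}
    (hf : ContDiff ℝ ∞ f) (hf' : HasFDerivAt f f' 0) (hf0 : f 0 = 0)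
    (hfq : ∀ w, q.toFun (f w) = p.toFun w) (v : EuclideanSpace ℝ (Fin p.dim)) :
    p.push v = q.push (f' v) := by
  rw [← hf'.fderiv]
  exact (Submodule.Quotient.eq (tangentRelations X x)).2
    (Submodule.subset_span ⟨p, q, f, v, hf, hf0, hfq, rfl⟩)

/-- A plot with value `x` at `a`, translated to a plot pointed at `x`. -/
def PointedPlot.translate {n : ℕ} (p : EuclideanSpace ℝ (Fin n) → X) (hp : IsPlot p)
    (a : EuclideanSpace ℝ (Fin n)) (ha : p a = x) : PointedPlot x where
  dim := n
  toFun := fun w => p (a + w)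
  isPlot := isPlot_reparam hp (contDiff_const.add contDiff_id)
  map_zero := by rw [add_zero, ha]

theorem exists_eq_push_translate {n : ℕ} {p : EuclideanSpace ℝ (Fin n) → X} {hp : IsPlot p}
    {z : EuclideanSpace ℝ (Fin n) × EuclideanSpace ℝ (Fin n)} {v : InternalTangentSpace X x}
    (h : tangentMap p hp z = ⟨x, v⟩) :
    ∃ hz : p z.1 = x, v = (PointedPlot.translate p hp z.1 hz).push z.2 := by
  have hz : p z.1 = x := congrArg Sigma.fst h
  subst hz
  exact ⟨rfl, (eq_of_heq (Sigma.mk.inj h).2).symm⟩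

/-- The tangent vector at `x` of a plot depends only on the germ of the plot. -/
theorem push_translate_comp {n m : ℕ} {p : EuclideanSpace ℝ (Fin n) → X} (hp : IsPlot p)
    {q : EuclideanSpace ℝ (Fin m) → X} (hq : IsPlot q)
    {f : EuclideanSpace ℝ (Fin n) → EuclideanSpace ℝ (Fin m)} (hf : ContDiff ℝ ∞ f)
    {a : EuclideanSpace ℝ (Fin n)} (hpq : p =ᶠ[𝓝 a] q ∘ f) (ha : p a = x) (hfa : q (f a) = x)
    (v : EuclideanSpace ℝ (Fin n)) :
    (PointedPlot.translate p hp a ha).push v =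
      (PointedPlot.translate q hq (f a) hfa).push (fderiv ℝ f a v) := by
  -- The defining relations need q ∘ f = p globally, not just near a. The plot p ∘ ρ has a morphism
  -- to each of the two plots, with derivatives the identity and that of f.
  obtain ⟨ρ, hρ, hρu, hρa⟩ := exists_contDiff_mapsTo_eventuallyEq_id hpq
  have hρa' : ρ a = a := hρa.eq_of_nhds
  let r : PointedPlot x := PointedPlot.translate (p ∘ ρ) (isPlot_reparam hp hρ) a
    (by rw [Function.comp_apply, hρa', ha])
  have hadd : HasFDerivAt (fun w : EuclideanSpace ℝ (Fin n) => a + w)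
      (ContinuousLinearMap.id ℝ _) 0 := (hasFDerivAt_id _).const_add a
  have hρ' : HasFDerivAt (fun w => ρ (a + w)) (ContinuousLinearMap.id ℝ _) 0 := by
    have : HasFDerivAt ρ (ContinuousLinearMap.id ℝ _) (a + 0) := by
      rw [add_zero]
      exact (hasFDerivAt_id a).congr_of_eventuallyEq hρa
    exact this.comp (0 : EuclideanSpace ℝ (Fin n)) hadd
  have hfρ : HasFDerivAt (fun w => f (ρ (a + w))) (fderiv ℝ f a) 0 := by
    have : HasFDerivAt f (fderiv ℝ f a) (ρ (a + 0)) := by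
      rw [add_zero, hρa']
      exact ((hf.differentiable (by simp)) a).hasFDerivAt
    exact this.comp (0 : EuclideanSpace ℝ (Fin n)) hρ'
  have hρs : ContDiff ℝ ∞ fun w => ρ (a + w) := hρ.comp (contDiff_const.add contDiff_id)
  have h1 := PointedPlot.push_eq_push_of_hasFDerivAt r (PointedPlot.translate p hp a ha)
    (f := fun w : EuclideanSpace ℝ (Fin n) => ρ (a + w) - a) (hρs.sub contDiff_const)
    (hρ'.sub_const a)     (show ρ (a + 0) - a = 0 by simp [hρa'])
    (fun w : EuclideanSpace ℝ (Fin n) => congrArg p (add_sub_cancel a (ρ (a + w)))) v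
  have h2 := PointedPlot.push_eq_push_of_hasFDerivAt r (PointedPlot.translate q hq (f a) hfa)
    (f := fun w : EuclideanSpace ℝ (Fin n) => f (ρ (a + w)) - f a)
    ((hf.comp hρs).sub contDiff_const) (hfρ.sub_const (f a))
    (show f (ρ (a + 0)) - f a = 0 by simp [hρa'])
    (fun w : EuclideanSpace ℝ (Fin n) =>
      (congrArg q (add_sub_cancel (f a) (f (ρ (a + w))))).trans (hρu (a + w)).symm) v
  exact h1.symm.trans h2

end Push

/-! ### Diffeologies on the tangent bundle from diffeologies on a tangent space -/

section Bundle

variable {B : Type*} {F : B → Type*} [DiffeologicalSpace B]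
  [∀ b, AddCommGroup (F b)] [∀ b, Module ℝ (F b)]

/-- The largest diffeology on the total space for which the projection is smooth and the fibre
over `x` carries a diffeology contained in `d`. -/
@[reducible]
def fibreDiffeology (x : B) (d : DiffeologicalSpace (F x)) : DiffeologicalSpace (Σ b, F b) where
  plots n := {P | IsPlot (fun w => (P w).1) ∧
    ∀ (m : ℕ) (φ : EuclideanSpace ℝ (Fin m) → EuclideanSpace ℝ (Fin n))
      (v : EuclideanSpace ℝ (Fin m) → F x), ContDiff ℝ ∞ φ → (∀ w, P (φ w) = ⟨x, v w⟩) → IsPlot v}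
  constant_plots {n} y := by
    refine ⟨isPlot_const, fun m φ v _ h => ?_⟩
    have : v = fun _ => v 0 := by
      funext w
      exact eq_of_heq (Sigma.mk.inj ((h w).symm.trans (h 0))).2
    rw [this]
    exact isPlot_const
  plot_reparam {n m P f} hP hf := ⟨isPlot_reparam hP.1 hf, fun k φ v hφ h =>
    hP.2 k (f ∘ φ) v (hf.comp hφ) h⟩
  locality {n P} hP := by
    refine ⟨DiffeologicalSpace.locality fun a => ?_, fun m φ v hφ h => ?_⟩
    · obtain ⟨u, hu, ha, hP⟩ := hP a
      exact ⟨u, hu, ha, fun hfu hf => (hP hfu hf).1⟩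
    · refine DiffeologicalSpace.locality fun a => ?_
      obtain ⟨u, hu, ha, hP⟩ := hP (φ a)
      exact ⟨φ ⁻¹' u, hu.preimage hφ.continuous, ha, fun {k f} hfu hf =>
        (hP (f := φ ∘ f) hfu (hφ.comp hf)).2 k id _ contDiff_id fun w => h (f w)⟩

/-- The operations preserve base points, and over x they are those of F x, where `hd` applies. -/
theorem isVectorPseudoBundle_fibreDiffeology (x : B) (d : DiffeologicalSpace (F x))
    (hd : IsDiffeologicalVectorSpace (F x)) :
    @IsVectorPseudoBundle B F _ _ _ (fibreDiffeology x d) := by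
  have lift : ∀ {m n : ℕ} {q : EuclideanSpace ℝ (Fin n) → B} (s : ∀ w, F (q w))
      {φ : EuclideanSpace ℝ (Fin m) → EuclideanSpace ℝ (Fin n)}, (∀ w, q (φ w) = x) →
      ∃ s' : EuclideanSpace ℝ (Fin m) → F x,
        ∀ w, (⟨q (φ w), s (φ w)⟩ : Σ b, F b) = ⟨x, s' w⟩ := fun s φ h =>
    ⟨fun w => h w ▸ s (φ w), fun w => Sigma.ext (h w) (by simp)⟩
  refine @IsVectorPseudoBundle.mk B F _ _ _ (fibreDiffeology x d) (fun n P hP => hP.1) ?_ ?_ ?_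
  · intro n q s t hs ht
    refine ⟨hs.1, fun m φ v hφ h => ?_⟩
    have hq : ∀ w, q (φ w) = x := fun w => congrArg Sigma.fst (h w)
    obtain ⟨s', hs'⟩ := lift s hq
    obtain ⟨t', ht'⟩ := lift t hq
    convert hd.add m s' t' (hs.2 m φ s' hφ hs') (ht.2 m φ t' hφ ht') using 1
    funext w
    have key : ∀ {b : B} {s t : F b} {s' t' v : F x}, (⟨b, s⟩ : Σ b, F b) = ⟨x, s'⟩ →
        (⟨b, t⟩ : Σ b, F b) = ⟨x, t'⟩ → (⟨b, s + t⟩ : Σ b, F b) = ⟨x, v⟩ → v = s' + t' := by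
      intro b s t s' t' v h1 h2 h3
      obtain rfl : b = x := congrArg Sigma.fst h1
      simp only [Sigma.mk.injEq, heq_eq_eq, true_and] at h1 h2 h3
      rw [← h1, ← h2, h3]
    exact key (hs' w) (ht' w) (h w)
  · intro n q r s hr hs
    refine ⟨hs.1, fun m φ v hφ h => ?_⟩
    obtain ⟨s', hs'⟩ := lift s fun w => congrArg Sigma.fst (h w)
    convert hd.smul m (r ∘ φ) s' (isPlot_reparam hr hφ) (hs.2 m φ s' hφ hs') using 1
    funext w
    have key : ∀ {b : B} {c : ℝ} {s : F b} {s' v : F x}, (⟨b, s⟩ : Σ b, F b) = ⟨x, s'⟩ →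
        (⟨b, c • s⟩ : Σ b, F b) = ⟨x, v⟩ → v = c • s' := by
      intro b c s s' v h1 h3
      obtain rfl : b = x := congrArg Sigma.fst h1
      simp only [Sigma.mk.injEq, heq_eq_eq, true_and] at h1 h3
      rw [← h1, h3]
    exact key (hs' w) (h w)
  · intro n p hp
    refine ⟨hp, fun m φ v hφ h => ?_⟩
    have : v = fun _ => 0 := by
      funext w
      have key : ∀ {b : B} {v : F x}, (⟨b, 0⟩ : Σ b, F b) = ⟨x, v⟩ → v = 0 := by
        intro b v h
        obtain rfl : b = x := congrArg Sigma.fst h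
        simpa using h.symm
      exact key (h w)
    rw [this]
    exact isPlot_const

end Bundle

/-! ### Reduction of fineness to plots of Hector's diffeology -/

section TangentBundle

variable {X : Type*} [DiffeologicalSpace X] (x : X)

theorem hectorDiffeology_le_iff {d : DiffeologicalSpace (InternalTangentBundle X)} :
    hectorDiffeology X ≤ d ↔ ∀ (n : ℕ) (p : EuclideanSpace ℝ (Fin n) → X) (hp : IsPlot p) (m : ℕ)
      (g : EuclideanSpace ℝ (Fin m) → EuclideanSpace ℝ (Fin n) × EuclideanSpace ℝ (Fin n)),
      ContDiff ℝ ∞ g → @IsPlot _ d m (fun w => tangentMap p hp (g w)) := by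
  rw [DiffeologicalSpace.generateFrom_le_iff]
  constructor
  · exact fun h n p hp m g hg => h m _ ⟨n, p, hp, m, g, hg, rfl⟩
  · rintro h m P ⟨n, p, hp, m', g, hg, hP⟩
    cases hP
    exact h n p hp m g hg

theorem isVectorPseudoBundle_dvsDiffeology :
    IsVectorPseudoBundle (InternalTangentSpace X) := by
  refine (isLeast_dvsification (InternalTangentSpace X) (hectorDiffeology X) ?_).1.2
  have : hectorDiffeology X ≤ inducedDiffeology Sigma.fst :=
    hectorDiffeology_le_iff.2 fun n p hp m g hg => isPlot_reparam hp hg.fst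
  exact DiffeologicalSpace.le_iff'.1 this

theorem isDiffeologicalVectorSpace_internalTangentSpace :
    IsDiffeologicalVectorSpace (InternalTangentSpace X x) where
  add n p q hp hq := isVectorPseudoBundle_dvsDiffeology.add n (fun _ => x) p q hp hq
  smul n r p hr hp := isVectorPseudoBundle_dvsDiffeology.smul n (fun _ => x) r p hr hp

/-- If the plots over `x` of Hector's diffeology are plots of every diffeology that makes `T_x X` a
diffeological vector space, then `T_x X` is fine. -/
theorem isFineDiffeologicalVectorSpace_of_forall_tangentMap
    (H : ∀ d : DiffeologicalSpace (InternalTangentSpace X x),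
      @IsDiffeologicalVectorSpace _ _ _ d →
      ∀ (n : ℕ) (p : EuclideanSpace ℝ (Fin n) → X) (hp : IsPlot p) (m : ℕ)
        (g : EuclideanSpace ℝ (Fin m) → EuclideanSpace ℝ (Fin n) × EuclideanSpace ℝ (Fin n))
        (v : EuclideanSpace ℝ (Fin m) → InternalTangentSpace X x), ContDiff ℝ ∞ g →
        (∀ w, tangentMap p hp (g w) = ⟨x, v w⟩) → @IsPlot _ d m v) :
    IsFineDiffeologicalVectorSpace (InternalTangentSpace X x) := by
  refine ⟨isDiffeologicalVectorSpace_internalTangentSpace x, fun d hd => ?_⟩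
  -- By minimality of the dvs diffeology, only Hector's generators need checking, and `H` is their
  -- fibre condition.
  have hle : dvsDiffeology X ≤ fibreDiffeology x d := by
    refine sInf_le ⟨hectorDiffeology_le_iff.2 fun n p hp m g hg => ?_,
      isVectorPseudoBundle_fibreDiffeology x d hd⟩
    exact ⟨isPlot_reparam hp hg.fst, fun k φ v hφ h => H d hd n p hp k (g ∘ φ) v (hg.comp hφ) h⟩
  exact DiffeologicalSpace.le_iff'.2 fun n v hv =>
    (DiffeologicalSpace.le_iff'.1 hle n _ hv).2 n id v contDiff_id fun _ => rfl

end TangentBundle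

/-- The pullback of the diffeology of ℝ along α is a vector space diffeology, hence contains the
fine one. -/
theorem IsFineDiffeologicalVectorSpace.dSmooth {V : Type*} [AddCommGroup V] [Module ℝ V]
    [DiffeologicalSpace V] (hV : IsFineDiffeologicalVectorSpace V) (α : V →ₗ[ℝ] ℝ) :
    DSmooth α := by
  refine DiffeologicalSpace.le_iff'.1 (hV.2 (?_ : inducedDiffeology α ∈ _))
  refine @IsDiffeologicalVectorSpace.mk V _ _ (inducedDiffeology α) (fun n p q hp hq => ?_)
    (fun n r p hr hp => ?_)
  · change IsPlot fun w => α (p w + q w)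
    simp only [map_add]
    exact (ContDiff.add (IsPlot.contDiff (X := ℝ) hp) (IsPlot.contDiff (X := ℝ) hq)).isPlot
  · change IsPlot fun w => α (r w • p w)
    simp only [map_smul, smul_eq_mul]
    exact (hr.contDiff.mul (IsPlot.contDiff (X := ℝ) hp)).isPlot

/-! ### The spaghetti plane -/

section SpaghettiPlane

/-- A smooth curve in the plane, as a map from the test space of dimension one. -/
def SpaghettiPlane.curve (c : ℝ → EuclideanSpace ℝ (Fin 2)) (t : EuclideanSpace ℝ (Fin 1)) :
    SpaghettiPlane :=
  c (t 0)

theorem SpaghettiPlane.isPlot_curve {c : ℝ → EuclideanSpace ℝ (Fin 2)} (hc : ContDiff ℝ ∞ c) :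
    IsPlot (SpaghettiPlane.curve c) :=
  DiffeologicalSpace.isPlot_generatedFrom_of_mem ⟨c, hc, rfl⟩

/-- The maps into the plane that locally factor smoothly through smooth curves. -/
@[reducible]
def curveFactoringDiffeology : DiffeologicalSpace SpaghettiPlane where
  plots n := {p | ∀ a, ∃ c : ℝ → EuclideanSpace ℝ (Fin 2), ContDiff ℝ ∞ c ∧
    ∃ f : EuclideanSpace ℝ (Fin n) → EuclideanSpace ℝ (Fin 1), ContDiff ℝ ∞ f ∧
      p =ᶠ[𝓝 a] SpaghettiPlane.curve c ∘ f}
  constant_plots y _ := ⟨fun _ => y, contDiff_const, fun _ => 0, contDiff_const, .rfl⟩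
  plot_reparam {n m p g} hp hg a := by
    obtain ⟨c, hc, f, hf, h⟩ := hp (g a)
    exact ⟨c, hc, f ∘ g, hf.comp hg, h.comp_tendsto hg.continuous.continuousAt⟩
  locality {n p} hp a := by
    obtain ⟨u, hu, ha, hp⟩ := hp a
    obtain ⟨ρ, hρ, hρu, hρa⟩ := exists_contDiff_mapsTo_eventuallyEq_id (hu.mem_nhds ha)
    obtain ⟨c, hc, f, hf, h⟩ := hp hρu hρ a
    refine ⟨c, hc, f, hf, ?_⟩
    filter_upwards [hρa, h] with w hw h
    rw [← h, Function.comp_apply, hw, id]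

/-- `curveFactoringDiffeology` contains the generating curves, hence every plot. -/
theorem SpaghettiPlane.exists_eventuallyEq_curve_comp {n : ℕ}
    {p : EuclideanSpace ℝ (Fin n) → SpaghettiPlane} (hp : IsPlot p)
    (a : EuclideanSpace ℝ (Fin n)) :
    ∃ c : ℝ → EuclideanSpace ℝ (Fin 2), ContDiff ℝ ∞ c ∧
      ∃ f : EuclideanSpace ℝ (Fin n) → EuclideanSpace ℝ (Fin 1), ContDiff ℝ ∞ f ∧
        p =ᶠ[𝓝 a] SpaghettiPlane.curve c ∘ f := by
  have hle : (inferInstance : DiffeologicalSpace SpaghettiPlane) ≤ curveFactoringDiffeology := by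
    refine DiffeologicalSpace.generateFrom_le_iff.2 ?_
    rintro n p ⟨c, hc, hP⟩
    cases hP
    exact fun a => ⟨c, hc, id, contDiff_id, .rfl⟩
  exact DiffeologicalSpace.le_iff'.1 hle n p hp a

variable {x : SpaghettiPlane}

/-- If a smooth curve is constant on an open set, then its tangent vector vanishes at each point
of the closure of this set. -/
theorem push_translate_curve_eq_zero {c : ℝ → EuclideanSpace ℝ (Fin 2)} (hc : ContDiff ℝ ∞ c)
    {U : Set ℝ} (hU : IsOpen U) (hcU : ∀ t ∈ U, c t = x) {s : EuclideanSpace ℝ (Fin 1)}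
    (hs : s 0 ∈ closure U) (hcs : SpaghettiPlane.curve c s = x) (v : EuclideanSpace ℝ (Fin 1)) :
    (PointedPlot.translate _ (SpaghettiPlane.isPlot_curve hc) s hcs).push v = 0 := by
  let y : EuclideanSpace ℝ (Fin 2) := x
  obtain ⟨G, hG, hGc⟩ := exists_contDiff_comp_pow_three (F := fun t => c (s 0 + t) - y)
    (U := Homeomorph.addLeft (s 0) ⁻¹' U) (hU.preimage (Homeomorph.continuous _))
    (by
      rw [← (Homeomorph.addLeft (s 0)).preimage_closure]
      simpa using hs)
    ((hc.comp (contDiff_const.add contDiff_id)).sub contDiff_const)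
    (fun t ht => sub_eq_zero.2 (hcU _ ht))
  -- In the single coordinate, f is the cube of w 0 - s 0, so its derivative vanishes at s.
  let f : EuclideanSpace ℝ (Fin 1) → EuclideanSpace ℝ (Fin 1) := fun w =>
    (w 0 - s 0) ^ 2 • (w - s)
  have hcoord : ContDiff ℝ ∞ fun w : EuclideanSpace ℝ (Fin 1) => w 0 - s 0 :=
    (contDiff_euclidean.1 contDiff_id 0).sub contDiff_const
  have hf : ContDiff ℝ ∞ f := (hcoord.pow 2).smul (contDiff_id.sub contDiff_const)
  have hf' : HasFDerivAt f (0 : _ →L[ℝ] EuclideanSpace ℝ (Fin 1)) s := by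
    have h1 : DifferentiableAt ℝ (fun w : EuclideanSpace ℝ (Fin 1) => (w 0 - s 0) ^ 2) s :=
      (hcoord.pow 2).differentiable (by simp) s
    have h2 : HasFDerivAt (fun w : EuclideanSpace ℝ (Fin 1) => w - s)
        (ContinuousLinearMap.id ℝ _) s := (hasFDerivAt_id s).sub_const s
    simpa using h1.hasFDerivAt.fun_smul h2
  have hcf : SpaghettiPlane.curve c = SpaghettiPlane.curve (fun u => G u + y) ∘ f := by
    funext w
    have : f w 0 = (w 0 - s 0) ^ 3 := by simp [f]; ring
    change c (w 0) = G (f w 0) + y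
    rw [this, hGc]
    simp
  rw [push_translate_comp (SpaghettiPlane.isPlot_curve hc)
    (SpaghettiPlane.isPlot_curve (hG.add contDiff_const)) hf (.of_eq hcf) hcs
    ((congrFun hcf s).symm.trans hcs), hf'.fderiv]
  exact map_zero _

/-- A plot over `x` of Hector's diffeology of the spaghetti plane is locally the product of a
smooth function and a vector of `T_x`. -/
theorem exists_eqOn_smul_of_tangentMap_eq {n m : ℕ}
    {p : EuclideanSpace ℝ (Fin n) → SpaghettiPlane} (hp : IsPlot p)
    {g : EuclideanSpace ℝ (Fin m) → EuclideanSpace ℝ (Fin n) × EuclideanSpace ℝ (Fin n)}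
    (hg : ContDiff ℝ ∞ g) {v : EuclideanSpace ℝ (Fin m) → InternalTangentSpace SpaghettiPlane x}
    (h : ∀ w, tangentMap p hp (g w) = ⟨x, v w⟩) (a : EuclideanSpace ℝ (Fin m)) :
    ∃ u, IsOpen u ∧ a ∈ u ∧ ∃ k : EuclideanSpace ℝ (Fin m) → ℝ, ContDiff ℝ ∞ k ∧
      ∃ e, ∀ w ∈ u, v w = k w • e := by
  obtain ⟨c, hc, f, hf, hpf⟩ := SpaghettiPlane.exists_eventuallyEq_curve_comp hp (g a).1
  -- Tangent vectors at all nearby points are compared, so p and c ∘ f must have equal germs at each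
  -- (g w).1; `eventuallyEq_nhds` supplies this.
  obtain ⟨ε, hε, hball⟩ := Metric.eventually_nhds_iff_ball.1
    ((hg.fst.continuous.tendsto a).eventually hpf.eventuallyEq_nhds)
  have hcw : ∀ w ∈ Metric.ball a ε, SpaghettiPlane.curve c (f (g w).1) = x := fun w hw =>
    (hball w hw).eq_of_nhds.symm.trans (congrArg Sigma.fst (h w))
  have hv : ∀ w (hw : w ∈ Metric.ball a ε), v w =
      (PointedPlot.translate _ (SpaghettiPlane.isPlot_curve hc) (f (g w).1) (hcw w hw)).push
        (fderiv ℝ f (g w).1 (g w).2) := by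
    intro w hw
    obtain ⟨hz, hvw⟩ := exists_eq_push_translate (h w)
    rw [hvw]
    exact push_translate_comp hp (SpaghettiPlane.isPlot_curve hc) hf (hball w hw) hz (hcw w hw) _
  refine ⟨Metric.ball a ε, Metric.isOpen_ball, Metric.mem_ball_self hε, ?_⟩
  let I : Set ℝ := (fun w => f (g w).1 0) '' Metric.ball a ε
  have hφ : ContDiff ℝ ∞ fun w => f (g w).1 := hf.comp hg.fst
  have hI : I.OrdConnected := by
    refine ((convex_ball a ε).isPreconnected.image _ ?_).ordConnected
    exact (contDiff_euclidean.1 hφ 0).continuous.continuousOn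
  rcases I.subsingleton_or_nontrivial with hsub | hnt
  · have ha := Metric.mem_ball_self (x := a) hε
    refine ⟨fun w => fderiv ℝ f (g w).1 (g w).2 0, ?_,
      (PointedPlot.translate _ (SpaghettiPlane.isPlot_curve hc) (f (g a).1) (hcw a ha)).push
        (EuclideanSpace.single (0 : Fin 1) (1 : ℝ)), fun w hw => ?_⟩
    · have hf' : ContDiff ℝ ∞ (fderiv ℝ f) := hf.fderiv_right (by simp)
      exact contDiff_euclidean.1 ((hf'.comp hg.fst).clm_apply hg.snd) 0
    · have hfw : f (g w).1 = f (g a).1 := by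
        ext i
        rw [Subsingleton.elim i 0]
        exact hsub ⟨w, hw, rfl⟩ ⟨a, ha, rfl⟩
      have key : ∀ {s t : EuclideanSpace ℝ (Fin 1)} (hs : SpaghettiPlane.curve c s = x)
          (ht : SpaghettiPlane.curve c t = x) (u : EuclideanSpace ℝ (Fin 1)), s = t →
          (PointedPlot.translate _ (SpaghettiPlane.isPlot_curve hc) s hs).push u =
            u 0 • (PointedPlot.translate _ (SpaghettiPlane.isPlot_curve hc) t ht).push
              (EuclideanSpace.single (0 : Fin 1) (1 : ℝ)) := by
        rintro s t hs ht u rfl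
        have hu : u = u 0 • EuclideanSpace.single (0 : Fin 1) (1 : ℝ) := by
          ext i
          rw [Subsingleton.elim i 0]
          simp
        conv_lhs => rw [hu]
        exact map_smul _ _ _
      rw [hv w hw]
      exact key _ _ _ hfw
  · refine ⟨fun _ => 0, contDiff_const, 0, fun w hw => ?_⟩
    have hconv : Convex ℝ I := hI.convex
    -- A nontrivial interval lies in the closure of its interior, where c = x.
    have hint : (interior I).Nonempty := hconv.nontrivial_iff_nonempty_interior.1 hnt
    rw [hv w hw, smul_zero]
    refine push_translate_curve_eq_zero hc (U := interior I) isOpen_interior ?_ ?_ _ _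
    · intro t ht
      obtain ⟨w', hw', rfl⟩ := interior_subset ht
      exact hcw w' hw'
    · rw [hconv.closure_interior_eq_closure_of_nonempty_interior hint]
      exact subset_closure ⟨w, hw, rfl⟩

theorem isFineDiffeologicalVectorSpace_internalTangentSpace_spaghettiPlane
    (x : SpaghettiPlane) :
    IsFineDiffeologicalVectorSpace (InternalTangentSpace SpaghettiPlane x) := by
  refine isFineDiffeologicalVectorSpace_of_forall_tangentMap x fun d hd n p hp m g v hg h =>
    DiffeologicalSpace.locality fun a => ?_
  obtain ⟨u, hu, ha, k, hk, e, he⟩ := exists_eqOn_smul_of_tangentMap_eq hp hg h a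
  refine ⟨u, hu, ha, fun {l φ} hφu hφ => ?_⟩
  have : v ∘ φ = fun w => k (φ w) • e := funext fun w => he _ (hφu w)
  rw [this]
  exact hd.smul l (k ∘ φ) (fun _ => e) (hk.comp hφ).isPlot isPlot_const

end SpaghettiPlane

end Diffeology

theorem proposition6p2 (x : Diffeology.SpaghettiPlane) :
    Diffeology.IsFineDiffeologicalVectorSpace
        (Diffeology.InternalTangentSpace Diffeology.SpaghettiPlane x) ∧
      ∀ α : Diffeology.InternalTangentSpace Diffeology.SpaghettiPlane x →ₗ[ℝ] ℝ,
        Diffeology.DSmooth α := by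
  have h := Diffeology.isFineDiffeologicalVectorSpace_internalTangentSpace_spaghettiPlane x
  exact ⟨h, h.dSmooth⟩
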